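/- Let $d\ge 1$ and let $\ell:[0,\infty)\to\mathbb{R}$ be continuous, increasing and strictly concave; put $c(x,y)=\ell(|x-y|)$ on $\mathbb{R}^d\times\mathbb{R}^d$. Let $\mu,\nu$ be mutually singular Borel probability measures on $\mathbb{R}^d$ such that $\mu(S)=0$ for every $\mathcal{H}^{d-1}$-rectifiable set $S$, i.e. every $S$ covered, up to an $\mathcal{H}^{d-1}$-null set, by countably many Lipschitz images of $\mathbb{R}^{d-1}$. Let $\gamma$ be an optimal transport plan, i.e. a minimizer of $\int c\,d\gamma$ (with finite value) among the measures on $\mathbb{R}^d\times\mathbb{R}^d$ with marginals $\mu$ and $\nu$. Let $\phi$ be a Kantorovich potential: with $\phi^c(y)=\inf_{x}\,(c(x,y)-\phi(x))$, the pair $(\phi,\phi^c)$ maximizes $\int\phi\,d\mu+\int\psi\,d\nu$ among the pairs $(\phi,\psi)$ of continuous functions with $\phi\in L^1(\mu)$, $\psi\in L^1(\nu)$ and $\phi(x)+\psi(y)\le c(x,y)$ for all $x,y$. Let $(B_i)_i$ be a countable family of closed balls of positive radius generating the topology of $\mathbb{R}^d$ (the open balls with the same centres and radii form a base), and let $$\phi_i(x)=\inf_{y\in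 B_i}\big(\ell(|x-y|)-\phi^c(y)\big),\qquad x\in\mathbb{R}^d.$$ For $x\in\mathbb{R}^d$, $|u|=1$ and $\delta,\epsilon>0$ let $C(x,u,\delta,\epsilon)=\{y:\langle y-x,u\rangle\ge(1-\delta)|y-x|,\ |y-x|\le\epsilon\}$. For each pair $i,i'$ let $\mu_{i,i'}$ be the restriction of $\mu$ to $\{\phi=\phi_i=\phi_{i'}\}$, and let $N_{i,i'}$ be the set of those $x\in\{\phi=\phi_i=\phi_{i'}\}$ for which $\mu_{i,i'}(C(x,u,\delta,\epsilon))=0$ for some $u,\delta,\epsilon$. Set $$N=\bigcup_{i,i'}N_{i,i'}\ \cup\bigcup_{i,j:\ d(B_i,B_j)>0}\{x\in B_j:\ \phi_i\text{ is not differentiable at }x\},$$ and let $A=\pi_x(\operatorname{spt}\gamma\setminus D)$, where $D=\{(x,x)\}$ is the diagonal and $\pi_x$ the projection to the first factor. Then: 1. $\mu(N)=0$ and $\mu(A)=1$. 2. For every $x\in A\setminus N$ there is an $i$ such that $\phi(x)=\phi_i(x)$ and $\phi_i$ is differentiable at $x$. 3. If $x\in A\setminus N$ and $\phi(x)=\phi_i(x)=\phi_{i'}(x)$,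 where $\phi_i$ and $\phi_{i'}$ are differentiable at $x$, then $\nabla\phi_i(x)=\nabla\phi_{i'}(x)$. 4. Consequently, for $\mu$-a.e. $x$ there is exactly one vector $v$ such that $v=\nabla\phi_i(x)$ for some $i$ for which $\phi(x)=\phi_i(x)$ and $\phi_i$ is differentiable at $x$; that is, the ad hoc gradient of $\phi$ is well defined $\mu$-a.e. -/

import Mathlib

open MeasureTheory Set
open scoped Gradient

namespace ConcaveTransport

/-- The Euclidean space of dimension `d`. -/
abbrev Space (d : ℕ) : Type := EuclideanSpace ℝ (Fin d)

variable {d : ℕ}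

/-- A subset of `ℝ^d` is `ℋ^k`-rectifiable if, up to an `ℋ^k`-null set, it is covered by
countably many Lipschitz images of `ℝ^k`. -/
def IsRectifiable (k : ℕ) (S : Set (Space d)) : Prop :=
  ∃ f : ℕ → Space k → Space d,
    (∀ n, ∃ K, LipschitzWith K (f n)) ∧
      Measure.hausdorffMeasure (k : ℝ) (S \ ⋃ n, range (f n)) = 0

/-- `μ` does not charge small sets: it gives no mass to `ℋ^{d-1}`-rectifiable sets. -/
def NotChargingSmallSets (μ : Measure (Space d)) : Prop :=
  ∀ S : Set (Space d), IsRectifiable (d - 1) S → μ S = 0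

/-- The cost `c(x, y) = ℓ(|x - y|)`. -/
noncomputable def radialCost (ℓ : ℝ → ℝ) (x y : Space d) : ℝ := ℓ ‖x - y‖

/-- Transport plans between `μ` and `ν`: measures on the product with marginals `μ` and `ν`. -/
def IsTransportPlan (μ ν : Measure (Space d)) (γ : Measure (Space d × Space d)) : Prop :=
  γ.map Prod.fst = μ ∧ γ.map Prod.snd = ν

/-- `γ` solves the Kantorovich problem. For a cost bounded from below, a plan for which the cost
is not integrable has cost `+∞`, so it is not a competitor. -/
def IsOptimalPlan (c : Space d → Space d → ℝ) (μ ν : Measure (Space d))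
    (γ : Measure (Space d × Space d)) : Prop :=
  IsTransportPlan μ ν γ ∧ Integrable (fun p => c p.1 p.2) γ ∧
    ∀ γ', IsTransportPlan μ ν γ' → Integrable (fun p => c p.1 p.2) γ' →
      ∫ p, c p.1 p.2 ∂γ ≤ ∫ p, c p.1 p.2 ∂γ'

/-- Admissible pairs of the dual problem: continuous integrable functions with
`φ(x) + ψ(y) ≤ c(x, y)` everywhere. -/
structure IsDualAdmissible (c : Space d → Space d → ℝ) (μ ν : Measure (Space d))
    (φ ψ : Space d → ℝ) : Prop where
  continuous_left : Continuous φ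
  continuous_right : Continuous ψ
  integrable_left : Integrable φ μ
  integrable_right : Integrable ψ ν
  add_le : ∀ x y, φ x + ψ y ≤ c x y

/-- The pair `(φ, ψ)` solves the dual problem. -/
def IsDualOptimal (c : Space d → Space d → ℝ) (μ ν : Measure (Space d))
    (φ ψ : Space d → ℝ) : Prop :=
  IsDualAdmissible c μ ν φ ψ ∧
    ∀ φ' ψ', IsDualAdmissible c μ ν φ' ψ' →
      ∫ x, φ' x ∂μ + ∫ y, ψ' y ∂ν ≤ ∫ x, φ x ∂μ + ∫ y, ψ y ∂ν

/-- The `c`-transform `φ^c(y) = inf_x c(x, y) - φ(x)`. -/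
noncomputable def cTransform (c : Space d → Space d → ℝ) (φ : Space d → ℝ) (y : Space d) : ℝ :=
  ⨅ x, (c x y - φ x)

/-- `φ` is a Kantorovich potential: `(φ, φ^c)` solves the dual problem. The constraint
`φ(x) + φ^c(y) ≤ c(x, y)` contained in it forces the infima defining `φ^c` to be finite. -/
def IsKantorovichPotential (c : Space d → Space d → ℝ) (μ ν : Measure (Space d))
    (φ : Space d → ℝ) : Prop :=
  IsDualOptimal c μ ν φ (cTransform c φ)

/-- The function `x ↦ inf_{y ∈ B} c(x, y) - φ^c(y)`. -/
noncomputable def localPotential (c : Space d → Space d → ℝ) (φ : Space d → ℝ)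
    (B : Set (Space d)) (x : Space d) : ℝ :=
  ⨅ y : B, (c x y - cTransform c φ y)

/-- The truncated cone `C(x, u, δ, ε)` with vertex `x` and direction `u`. -/
def cone (x u : Space d) (δ ε : ℝ) : Set (Space d) :=
  {y | (1 - δ) * ‖y - x‖ ≤ inner ℝ (y - x) u} ∩ Metric.closedBall x ε

/-- The points all of whose cones have positive mass. -/
def isotropicSet (μ : Measure (Space d)) : Set (Space d) :=
  {x | ∀ u : Space d, ‖u‖ = 1 → ∀ δ > 0, ∀ ε > 0, 0 < μ (cone x u δ ε)}

/-- The coincidence set `{φ = φ_i = φ_{i'}}` for two regions `B = B_i` and `B' = B_{i'}`. -/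
def coincidenceSet (c : Space d → Space d → ℝ) (φ : Space d → ℝ) (B B' : Set (Space d)) :
    Set (Space d) :=
  {x | φ x = localPotential c φ B x ∧ φ x = localPotential c φ B' x}

/-- The exceptional set `N_{i,i'}` of the cone lemma: the points of the coincidence set at which
some cone has zero mass for the restriction of `μ` to the coincidence set. -/
def coneExceptionalSet (c : Space d → Space d → ℝ) (μ : Measure (Space d)) (φ : Space d → ℝ)
    (B B' : Set (Space d)) : Set (Space d) :=
  coincidenceSet c φ B B' \ isotropicSet (μ.restrict (coincidenceSet c φ B B'))

/-- The set `N`: the union of all the `N_{i,i'}` and of all the sets of points of `B_j` at which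
`φ_i` is not differentiable, over the pairs `i, j` such that `B_i` and `B_j` are at positive
distance. -/
def exceptionalSet {ι : Type*} (c : Space d → Space d → ℝ) (μ : Measure (Space d))
    (φ : Space d → ℝ) (B : ι → Set (Space d)) : Set (Space d) :=
  (⋃ (i) (i'), coneExceptionalSet c μ φ (B i) (B i')) ∪
    ⋃ (i) (j) (_ : Metric.AreSeparated (B i) (B j)),
      {x ∈ B j | ¬ DifferentiableAt ℝ (localPotential c φ (B i)) x}

/-- The set `π_x(spt γ \ D)`, with `D` the diagonal. -/
def movedSet (γ : Measure (Space d × Space d)) : Set (Space d) :=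
  Prod.fst '' (γ.support \ diagonal (Space d))

/-- `v` is a value at `x` of the ad hoc gradient of `φ`: it is the gradient at `x` of some `φ_i`
which coincides with `φ` at `x`. -/
def IsAdHocGradient {ι : Type*} (c : Space d → Space d → ℝ) (φ : Space d → ℝ)
    (B : ι → Set (Space d)) (x v : Space d) : Prop :=
  ∃ i, φ x = localPotential c φ (B i) x ∧ HasGradientAt (localPotential c φ (B i)) v x

end ConcaveTransport

open ConcaveTransport

/-! Let (x, y) ∈ spt γ with y ≠ x. Complementary slackness (`add_cTransform_eq_of_mem_support`)
gives φ(x) + φ^c(y) = c(x, y), so φ(x) = φ_i(x) as soon as y ∈ B_i. Choose B_i at positive distance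
from some B_j containing x. Away from B_i the costs z ↦ c(z, y'), y' ∈ B_i, have bounded
supergradients with a uniform quadratic error. This passes to their infimum φ_i, which is therefore
differentiable at μ-almost every point of B_j.

If φ_i and φ_{i'} both equal φ at x, their difference vanishes on the coincidence set. Outside N
that set meets every small cone at x away from the vertex, so a nonzero difference of gradients
would be seen along some chord (`gradient_eq_of_mem_isotropicSet`).

Both null-set results rest on one geometric fact (`measure_eq_zero_of_abs_inner_le`): if the short
chords of a set avoid a double cone around a fixed axis, the set is covered by countably many
Lipschitz graphs over a hyperplane.

Slackness requires the absence of a duality gap. The support of γ is cyclically monotone, and c -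
ℓ(0) satisfies the triangle inequality, so a shortest-path construction gives a potential saturated
on spt γ. Its truncations compete in the dual problem and push the dual value up to the primal one.
-/

namespace ConcaveTransport

variable {d : ℕ}

/-! ### Lipschitz graphs and the cone lemma -/

/-- The coordinates of the orthogonal projection onto the hyperplane orthogonal to a unit vector. -/
lemma exists_hyperplane_coordinates (hd : 1 ≤ d) (u : Space d) (hu : ‖u‖ = 1) :
    ∃ T : Space d →ₗ[ℝ] Space (d - 1), ∀ z, ‖z‖ ^ 2 = ‖T z‖ ^ 2 + (inner ℝ z u) ^ 2 := by
  have : Fact (Module.finrank ℝ (Space d) = (d - 1) + 1) := ⟨by simp; omega⟩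
  have hu0 : u ≠ 0 := by rintro rfl; simp at hu
  let b := OrthonormalBasis.fromOrthogonalSpanSingleton (𝕜 := ℝ) (d - 1) hu0
  refine ⟨b.repr.toLinearEquiv.toLinearMap ∘ₗ
    ((ℝ ∙ u)ᗮ.orthogonalProjectionOnto : Space d →ₗ[ℝ] (ℝ ∙ u)ᗮ), fun z => ?_⟩
  have h := Submodule.norm_sq_eq_add_norm_sq_projection z (ℝ ∙ u)
  rw [h, add_comm]
  congr 1
  · simp
  · rw [← Submodule.norm_coe, ← Submodule.starProjection_apply,
      Submodule.starProjection_unit_singleton ℝ hu, norm_smul, hu, mul_one, real_inner_comm]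
    simp

/-- A set whose chords avoid a cone around the direction `u` is contained in a Lipschitz graph. -/
lemma isRectifiable_of_abs_inner_le (hd : 1 ≤ d) {S : Set (Space d)} {u : Space d} (hu : ‖u‖ = 1)
    {θ : ℝ} (hθ0 : 0 ≤ θ) (hθ : θ < 1)
    (hS : ∀ x ∈ S, ∀ y ∈ S, |inner ℝ (y - x) u| ≤ θ * ‖y - x‖) : IsRectifiable (d - 1) S := by
  obtain ⟨T, hT⟩ := exists_hyperplane_coordinates hd u hu
  have h1 : 0 < 1 - θ ^ 2 := by nlinarith
  -- For a chord z of S, Pythagoras and |⟨z, u⟩| ≤ θ‖z‖ give (1 - θ²)‖z‖² ≤ ‖T z‖², so S is a graph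
  -- over its projection. The inverse of T on S is Lipschitz and extends to the whole hyperplane.
  have hanti : AntilipschitzWith (Real.toNNReal (√(1 - θ ^ 2))⁻¹) (S.domRestrict T) := by
    refine AntilipschitzWith.of_le_mul_dist fun x y => ?_
    rw [Real.coe_toNNReal _ (by positivity), Subtype.dist_eq, dist_eq_norm, dist_eq_norm,
      Set.domRestrict_apply, Set.domRestrict_apply, ← map_sub, inv_mul_eq_div,
      le_div_iff₀ (Real.sqrt_pos.2 h1)]
    apply le_of_sq_le_sq _ (norm_nonneg _)
    rw [mul_pow, Real.sq_sqrt h1.le]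
    have h2 := hS y y.2 x x.2
    have h3 := hT ((x : Space d) - y)
    have h4 := pow_le_pow_left₀ (abs_nonneg _) h2 2
    rw [sq_abs, mul_pow] at h4
    nlinarith
  have hinj : InjOn T S := by
    rw [injOn_iff_injective]; exact hanti.injective
  have hinv : LeftInvOn (Function.invFunOn T S) T S := hinj.leftInvOn_invFunOn
  have hlip := hanti.to_rightInvOn' (g := Function.invFunOn T S) (t := T '' S)
    (fun z hz => Function.invFunOn_mem hz) (fun z hz => Function.invFunOn_eq hz)
  obtain ⟨g, hg, hgE⟩ := (lipschitzOnWith_iff_restrict.2 hlip).extend_finite_dimension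
  refine ⟨fun _ => g, fun _ => ⟨_, hg⟩, ?_⟩
  have : S \ ⋃ _ : ℕ, range g = ∅ := by
    rw [sdiff_eq_empty]
    intro x hx
    refine mem_iUnion.2 ⟨0, T x, ?_⟩
    rw [← hgE (mem_image_of_mem T hx), hinv hx]
  rw [this, measure_empty]

/-- The chord condition is only needed at small scale: countably many balls of radius ε/2 cover the
space, and the trace of S on each of them is rectifiable. -/
lemma measure_eq_zero_of_abs_inner_le (hd : 1 ≤ d) {μ : Measure (Space d)}
    (hμ : NotChargingSmallSets μ) {S : Set (Space d)} {u : Space d} (hu : ‖u‖ = 1)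
    {θ ε : ℝ} (hθ0 : 0 ≤ θ) (hθ : θ < 1) (hε : 0 < ε)
    (hS : ∀ x ∈ S, ∀ y ∈ S, dist x y < ε → |inner ℝ (y - x) u| ≤ θ * ‖y - x‖) : μ S = 0 := by
  obtain ⟨D, hDc, hD⟩ := TopologicalSpace.exists_countable_dense (Space d)
  have hcov : S ⊆ ⋃ q ∈ D, S ∩ Metric.ball q (ε / 2) := by
    intro x hx
    obtain ⟨q, hq, hxq⟩ := hD.exists_dist_lt x (half_pos hε)
    exact mem_biUnion hq ⟨hx, hxq⟩
  refine measure_mono_null hcov ((measure_biUnion_null_iff hDc).2 fun q _ => hμ _ ?_)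
  refine isRectifiable_of_abs_inner_le hd hu hθ0 hθ fun x hx y hy => hS x hx.1 y hy.1 ?_
  have := dist_triangle_right x y q
  have h1 := Metric.mem_ball.1 hx.2
  have h2 := Metric.mem_ball.1 hy.2
  linarith

/-- Tilting the axis changes the inner product by at most ‖u' - u‖‖y - x‖, which the larger aperture
absorbs. This reduces the cone lemma to countably many cones. -/
lemma cone_subset_cone {x u u' : Space d} {δ δ' ε ε' : ℝ} (hu : ‖u' - u‖ ≤ δ - δ')
    (hε : ε' ≤ ε) : cone x u' δ' ε' ⊆ cone x u δ ε := by
  rintro y ⟨h1, h2⟩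
  refine ⟨?_, Metric.closedBall_subset_closedBall hε h2⟩
  simp only [mem_ofPred_eq] at h1 ⊢
  have h3 : inner ℝ (y - x) u' = inner ℝ (y - x) u + inner ℝ (y - x) (u' - u) := by
    rw [inner_sub_right]; ring
  have h4 := real_inner_le_norm (y - x) (u' - u)
  have h5 := mul_le_mul_of_nonneg_left hu (norm_nonneg (y - x))
  nlinarith

/-- The cone lemma for a fixed cone. -/
lemma measure_null_cone_eq_zero (hd : 1 ≤ d) {μ : Measure (Space d)}
    (hμ : NotChargingSmallSets μ) (E : Set (Space d)) {u : Space d} (hu : ‖u‖ = 1)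
    {δ ε : ℝ} (hδ : 0 < δ) (hδ1 : δ ≤ 1) (hε : 0 < ε) :
    μ {x ∈ E | μ.restrict E (cone x u δ ε) = 0} = 0 := by
  set F := {x ∈ E | μ.restrict E (cone x u δ ε) = 0} with hF
  have hFE : F ⊆ E := fun x hx => hx.1
  -- Almost all of F lies in the support of its own restricted measure. There every neighbourhood of
  -- a point carries mass of F, so the open cone at one point cannot contain a nearby one: the cone
  -- would have positive mass. Exchanging the two points excludes the opposite cone.
  have hsplit : F ⊆ F ∩ (μ.restrict F).support ∪ F ∩ (μ.restrict F).supportᶜ := by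
    rw [← inter_union_distrib_left, union_compl_self, inter_univ]
  refine measure_mono_null hsplit (measure_union_null ?_ ?_)
  · refine measure_eq_zero_of_abs_inner_le hd hμ hu (θ := 1 - δ) (by linarith) (by linarith) hε ?_
    have key : ∀ x ∈ F ∩ (μ.restrict F).support, ∀ y ∈ F ∩ (μ.restrict F).support, dist x y < ε →
        inner ℝ (y - x) u ≤ (1 - δ) * ‖y - x‖ := by
      intro x hx y hy hxy
      by_contra! hlt
      have hO : IsOpen ({z | (1 - δ) * ‖z - x‖ < inner ℝ (z - x) u} ∩ Metric.ball x ε) := by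
        refine IsOpen.inter (isOpen_lt (by fun_prop) (by fun_prop)) Metric.isOpen_ball
      have hpos := (Measure.mem_support_iff_forall y).1 hy.2 _
        (hO.mem_nhds ⟨hlt, by rwa [Metric.mem_ball, dist_comm]⟩)
      refine hpos.ne' (le_antisymm ?_ zero_le)
      rw [← hx.1.2]
      refine (Measure.restrict_mono hFE le_rfl _).trans (measure_mono ?_)
      exact inter_subset_inter (fun z hz => by
        simp only [mem_ofPred_eq] at hz ⊢; exact hz.le) Metric.ball_subset_closedBall
    intro x hx y hy hxy
    rw [abs_le]
    constructor
    · have := key y hy x hx (by rwa [dist_comm])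
      rw [← neg_sub, inner_neg_left, norm_neg] at this
      linarith
    · exact key x hx y hy hxy
  · have := Measure.measure_compl_support (μ := μ.restrict F)
    rwa [Measure.restrict_apply Measure.isClosed_support.measurableSet.compl, inter_comm] at this

/-- The cone lemma: if `μ` does not charge small sets, almost every point of `E` sees mass of `E`
in all directions. -/
lemma measure_diff_isotropicSet (hd : 1 ≤ d) {μ : Measure (Space d)}
    (hμ : NotChargingSmallSets μ) (E : Set (Space d)) :
    μ (E \ isotropicSet (μ.restrict E)) = 0 := by
  obtain ⟨D, hDc, hD⟩ :=
    TopologicalSpace.exists_countable_dense (Metric.sphere (0 : Space d) 1)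
  have hcov : E \ isotropicSet (μ.restrict E) ⊆ ⋃ v ∈ D, ⋃ n : ℕ,
      {x ∈ E | μ.restrict E (cone x v (1 / ((n : ℝ) + 1)) (1 / ((n : ℝ) + 1))) = 0} := by
    rintro x ⟨hxE, hx⟩
    simp only [isotropicSet, mem_ofPred_eq, not_forall, not_lt, nonpos_iff_eq_zero] at hx
    obtain ⟨u, hu, δ, hδ, ε, hε, h0⟩ := hx
    -- Half of δ pays for the tilt from u to v, the other half for the new aperture.
    obtain ⟨n, hn⟩ := exists_nat_one_div_lt (lt_min (half_pos hδ) hε)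
    obtain ⟨v, hv, huv⟩ := hD.exists_dist_lt ⟨u, by simpa using hu⟩ (half_pos hδ)
    refine mem_biUnion hv (mem_iUnion.2 ⟨n, hxE, measure_mono_null (cone_subset_cone ?_ ?_) h0⟩)
    · rw [dist_comm, Subtype.dist_eq, dist_eq_norm] at huv
      have := hn.trans_le (min_le_left _ _)
      simp only at huv
      linarith
    · exact (hn.trans_le (min_le_right _ _)).le
  refine measure_mono_null hcov ((measure_biUnion_null_iff hDc).2 fun v _ =>
    measure_iUnion_null fun n => ?_)
  refine measure_null_cone_eq_zero hd hμ E (by simp) (by positivity) ?_ (by positivity)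
  rw [div_le_one (by positivity)]
  linarith [(Nat.cast_nonneg n : (0 : ℝ) ≤ n)]

lemma NotChargingSmallSets.noAtoms {μ : Measure (Space d)} (hμ : NotChargingSmallSets μ)
    (x : Space d) : μ {x} = 0 := by
  refine hμ _ ⟨fun _ _ => x, fun _ => ⟨0, LipschitzWith.const x⟩, ?_⟩
  simp

/-! ### Differentiability almost everywhere from supergradients -/

/-- `p` is a supergradient of `f` at `x` over `U`, up to the quadratic error `C|z - x|²`. -/
def IsSupergradient (f : Space d → ℝ) (U : Set (Space d)) (C : ℝ) (x p : Space d) : Prop :=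
  ∀ z ∈ U, f z ≤ f x + inner ℝ p (z - x) + C * ‖z - x‖ ^ 2

open Filter Topology in
/-- A locally bounded field of supergradients with a unique value at `x` makes `f` differentiable
at `x`. -/
lemma differentiableAt_of_unique_supergradient {f : Space d → ℝ} {U : Set (Space d)}
    (hU : IsOpen U) {C M : ℝ}
    (hf : ∀ x ∈ U, ∃ p, ‖p‖ ≤ M ∧ IsSupergradient f U C x p)
    {x : Space d} (hx : x ∈ U)
    (huniq : ∀ p q, IsSupergradient f U C x p → IsSupergradient f U C x q → p = q) :
    DifferentiableAt ℝ f x := by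
  obtain ⟨p, hpM, hp⟩ := hf x hx
  have hUx : U ∈ 𝓝 x := hU.mem_nhds hx
  choose! P hPM hP using hf
  -- The supergradient inequality at z, tested at x, bounds f from below near x.
  have hlower : ∀ z ∈ U, f x + inner ℝ (P z) (z - x) - C * ‖z - x‖ ^ 2 ≤ f z := by
    intro z hz
    have := hP z hz x hx
    rw [← neg_sub z x, inner_neg_right, norm_neg] at this
    linarith
  have hcont : Tendsto f (𝓝 x) (𝓝 (f x)) := by
    have hup : Tendsto (fun z => f x + inner ℝ p (z - x) + C * ‖z - x‖ ^ 2) (𝓝 x) (𝓝 (f x)) := by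
      have : Continuous fun z => f x + inner ℝ p (z - x) + C * ‖z - x‖ ^ 2 := by fun_prop
      simpa using this.tendsto x
    have hlo : Tendsto (fun z => f x - M * ‖z - x‖ - C * ‖z - x‖ ^ 2) (𝓝 x) (𝓝 (f x)) := by
      have : Continuous fun z => f x - M * ‖z - x‖ - C * ‖z - x‖ ^ 2 := by fun_prop
      simpa using this.tendsto x
    refine tendsto_of_tendsto_of_tendsto_of_le_of_le' hlo hup ?_ ?_
    · filter_upwards [hUx] with z hz
      have h1 := hlower z hz
      have h2 := (abs_le.1 (abs_real_inner_le_norm (P z) (z - x))).1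
      have h3 := mul_le_mul_of_nonneg_right (hPM z hz) (norm_nonneg (z - x))
      linarith
    · filter_upwards [hUx] with z hz using hp z hz
  -- Supergradients form a closed relation: any cluster point of P at x is a supergradient at x,
  -- hence equals p. Boundedness turns this into convergence, and f is then squeezed between two
  -- expansions of slope close to p.
  have hPtend : Tendsto P (𝓝 x) (𝓝 p) := by
    refine (isCompact_closedBall (0 : Space d) M).tendsto_nhds_of_unique_mapClusterPt ?_ ?_
    · filter_upwards [hUx] with z hz
      simpa using hPM z hz
    · intro q _ hq
      refine huniq q p ?_ hp
      intro w hw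
      obtain ⟨F, hF, hFq⟩ := mapClusterPt_iff_ultrafilter.1 hq
      have hid : Tendsto (fun z : Space d => z) F (𝓝 x) := hF
      have hsub : Tendsto (fun z => w - z) F (𝓝 (w - x)) := tendsto_const_nhds.sub hid
      refine ge_of_tendsto (((hcont.mono_left hF).add (hFq.inner hsub)).add
        ((hsub.norm.pow 2).const_mul C)) ?_
      filter_upwards [hF hUx] with z hz using hP z hz w hw
  refine HasFDerivAt.differentiableAt (f' := (innerSL ℝ p)) ?_
  rw [hasFDerivAt_iff_isLittleO, Asymptotics.isLittleO_iff]
  intro c hc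
  have hsmall1 : ∀ᶠ z in 𝓝 x, ‖P z - p‖ < c / 2 := by
    have : Tendsto (fun z => ‖P z - p‖) (𝓝 x) (𝓝 0) := by
      simpa using (hPtend.sub_const p).norm
    exact this.eventually_lt_const (half_pos hc)
  have hsmall2 : ∀ᶠ z in 𝓝 x, |C| * ‖z - x‖ < c / 2 := by
    have : Tendsto (fun z => |C| * ‖z - x‖) (𝓝 x) (𝓝 0) := by
      have : Continuous fun z => |C| * ‖z - x‖ := by fun_prop
      simpa using this.tendsto x
    exact this.eventually_lt_const (half_pos hc)
  filter_upwards [hUx, hsmall1, hsmall2] with z hz h1 h2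
  have hn := norm_nonneg (z - x)
  have hC : C * ‖z - x‖ ^ 2 ≤ (c / 2) * ‖z - x‖ := by
    have h3 := mul_le_mul_of_nonneg_right h2.le hn
    have h4 := mul_le_mul_of_nonneg_right (le_abs_self C) (sq_nonneg ‖z - x‖)
    nlinarith
  have hup := hp z hz
  have hlo := hlower z hz
  have h5 : inner ℝ (P z) (z - x) = inner ℝ p (z - x) + inner ℝ (P z - p) (z - x) := by
    rw [inner_sub_left]; ring
  have h6 := (abs_le.1 (abs_real_inner_le_norm (P z - p) (z - x))).1
  have h7 := mul_le_mul_of_nonneg_right h1.le hn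
  rw [Real.norm_eq_abs, innerSL_apply_apply, abs_le]
  constructor <;> nlinarith

/-- The set of points with two supergradients close to two given distinct vectors is null. -/
lemma measure_two_supergradients_eq_zero (hd : 1 ≤ d) {μ : Measure (Space d)}
    (hμ : NotChargingSmallSets μ) (f : Space d → ℝ) (U : Set (Space d)) (C : ℝ)
    {p₀ q₀ : Space d} {η : ℝ} (hη : 0 < η) (hpq : 6 * η ≤ ‖p₀ - q₀‖) :
    μ {x ∈ U | ∃ p q, ‖p - p₀‖ ≤ η ∧ ‖q - q₀‖ ≤ η ∧
      IsSupergradient f U C x p ∧ IsSupergradient f U C x q} = 0 := by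
  have hpos : 0 < ‖p₀ - q₀‖ := by linarith
  refine measure_eq_zero_of_abs_inner_le hd hμ (u := ‖p₀ - q₀‖⁻¹ • (p₀ - q₀)) (θ := 1 / 2)
    (ε := η / (2 * |C| + 1)) ?_ (by norm_num) (by norm_num) (by positivity) ?_
  · rw [norm_smul, norm_inv, norm_norm, inv_mul_cancel₀ hpos.ne']
  -- Adding the inequalities for q at x and p at y gives ⟨p - q, y - x⟩ ≤ 2C‖y - x‖². Replacing p, q
  -- by p₀, q₀ costs 2η‖y - x‖, and the quadratic term costs at most η‖y - x‖ at the chosen scale.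
  -- Since 6η ≤ ‖p₀ - q₀‖, the slope is at most 1/2.
  have key : ∀ x ∈ U, ∀ y ∈ U, ∀ q p, ‖p - p₀‖ ≤ η → ‖q - q₀‖ ≤ η →
      IsSupergradient f U C x q → IsSupergradient f U C y p →
      dist x y < η / (2 * |C| + 1) → inner ℝ (y - x) (p₀ - q₀) ≤ 3 * η * ‖y - x‖ := by
    intro x hx y hy q p hp hq hxq hyp hxy
    have h1 := hxq y hy
    have h2 := hyp x hx
    rw [← neg_sub y x, inner_neg_right, norm_neg] at h2
    have hn := norm_nonneg (y - x)
    have h3 : 2 * C * ‖y - x‖ ^ 2 ≤ η * ‖y - x‖ := by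
      rw [dist_comm, dist_eq_norm, lt_div_iff₀ (by positivity)] at hxy
      have h4 := mul_le_mul_of_nonneg_right hxy.le hn
      have h5 := mul_le_mul_of_nonneg_right (le_abs_self C) (sq_nonneg ‖y - x‖)
      nlinarith
    have h6 : inner ℝ (y - x) (p₀ - q₀) = inner ℝ p (y - x) - inner ℝ q (y - x)
        - inner ℝ (p - p₀) (y - x) + inner ℝ (q - q₀) (y - x) := by
      rw [real_inner_comm]; simp only [inner_sub_left]; ring
    have h7 := (abs_le.1 (abs_real_inner_le_norm (p - p₀) (y - x))).1
    have h8 := (abs_le.1 (abs_real_inner_le_norm (q - q₀) (y - x))).2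
    have h9 := mul_le_mul_of_nonneg_right hp hn
    have h10 := mul_le_mul_of_nonneg_right hq hn
    linarith
  rintro x ⟨hxU, p, q, hp, hq, hxp, hxq⟩ y ⟨hyU, p', q', hp', hq', hyp, hyq⟩ hxy
  have h1 := key x hxU y hyU q p' hp' hq hxq hyp hxy
  have h2 := key y hyU x hxU q' p hp hq' hyq hxp (by rwa [dist_comm])
  rw [← neg_sub y x, inner_neg_left, norm_neg] at h2
  rw [inner_smul_right, abs_mul, abs_of_pos (inv_pos.2 hpos), inv_mul_eq_div,
    div_le_iff₀ hpos, abs_le]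
  have h3 := mul_le_mul_of_nonneg_right hpq (norm_nonneg (y - x))
  constructor <;> linarith

/-- A function with locally bounded supergradients is differentiable almost everywhere with
respect to measures not charging small sets. -/
lemma measure_not_differentiableAt_eq_zero (hd : 1 ≤ d) {μ : Measure (Space d)}
    (hμ : NotChargingSmallSets μ) {f : Space d → ℝ} {U : Set (Space d)} (hU : IsOpen U)
    {C M : ℝ} (hf : ∀ x ∈ U, ∃ p, ‖p‖ ≤ M ∧ IsSupergradient f U C x p) :
    μ {x ∈ U | ¬ DifferentiableAt ℝ f x} = 0 := by
  obtain ⟨D, hDc, hD⟩ := TopologicalSpace.exists_countable_dense (Space d)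
  have hcov : {x ∈ U | ¬ DifferentiableAt ℝ f x} ⊆
      ⋃ p₀ ∈ D, ⋃ q₀ ∈ D, ⋃ n : ℕ, ⋃ _ : 6 * (1 / ((n : ℝ) + 1)) ≤ ‖p₀ - q₀‖,
        {x ∈ U | ∃ p q, ‖p - p₀‖ ≤ 1 / ((n : ℝ) + 1) ∧ ‖q - q₀‖ ≤ 1 / ((n : ℝ) + 1) ∧
          IsSupergradient f U C x p ∧ IsSupergradient f U C x q} := by
    rintro x ⟨hxU, hx⟩
    have h := mt (differentiableAt_of_unique_supergradient hU hf hxU) hx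
    push Not at h
    obtain ⟨p, q, hp, hq, hpq⟩ := h
    have hpos : 0 < ‖p - q‖ := norm_pos_iff.2 (sub_ne_zero.2 hpq)
    -- With η = 1/(n+1) below ‖p - q‖/8, approximating p and q within η loses at most 2η and leaves
    -- ‖p₀ - q₀‖ ≥ 6η.
    obtain ⟨n, hn⟩ := exists_nat_one_div_lt (div_pos hpos (by norm_num : (0 : ℝ) < 8))
    have hn0 : 0 < 1 / ((n : ℝ) + 1) := by positivity
    obtain ⟨p₀, hp₀, hpp⟩ := hD.exists_dist_lt p hn0
    obtain ⟨q₀, hq₀, hqq⟩ := hD.exists_dist_lt q hn0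
    rw [dist_eq_norm] at hpp hqq
    simp only [mem_iUnion]
    refine ⟨p₀, hp₀, q₀, hq₀, n, ?_, hxU, p, q, hpp.le, hqq.le, hp, hq⟩
    have h1 : p - q = (p - p₀) + (p₀ - q₀) - (q - q₀) := by abel
    have h2 := norm_sub_le ((p - p₀) + (p₀ - q₀)) (q - q₀)
    have h3 := norm_add_le (p - p₀) (p₀ - q₀)
    rw [← h1] at h2
    linarith
  refine measure_mono_null hcov ((measure_biUnion_null_iff hDc).2 fun p₀ _ =>
    (measure_biUnion_null_iff hDc).2 fun q₀ _ => measure_iUnion_null fun n =>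
      measure_iUnion_null fun h => ?_)
  exact measure_two_supergradients_eq_zero hd hμ f U C (by positivity) h

/-! ### Concave functions and radial costs -/

/-- Both s and t are convex combinations of s + t and 0, with exchanged weights; the two concavity
inequalities are added. -/
lemma concaveOn_subadditive {ℓ : ℝ → ℝ} (hℓ : ConcaveOn ℝ (Ici 0) ℓ) {s t : ℝ} (hs : 0 ≤ s)
    (ht : 0 ≤ t) : ℓ (s + t) + ℓ 0 ≤ ℓ s + ℓ t := by
  rcases (add_nonneg hs ht).eq_or_lt with h | h
  · obtain rfl : s = 0 := by linarith
    simp [add_comm]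
  have key : ∀ a b : ℝ, 0 ≤ a → 0 ≤ b → 0 < a + b →
      a / (a + b) * ℓ (a + b) + b / (a + b) * ℓ 0 ≤ ℓ a := by
    intro a b ha hb hab
    have := hℓ.2 (mem_Ici.2 hab.le) (mem_Ici.2 le_rfl) (div_nonneg ha hab.le)
      (div_nonneg hb hab.le) (by field_simp)
    simpa [smul_eq_mul, div_mul_cancel₀ _ hab.ne'] using this
  have h1 := key s t hs ht h
  have h2 := key t s ht hs (by linarith)
  rw [add_comm t s] at h2
  have h3 : ℓ (s + t) + ℓ 0 = (s / (s + t) * ℓ (s + t) + t / (s + t) * ℓ 0) +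
      (t / (s + t) * ℓ (s + t) + s / (s + t) * ℓ 0) := by field_simp; ring
  linarith

/-- Supergradients of a concave monotone function on the half-line. -/
lemma exists_supergradient_of_concaveOn {ℓ : ℝ → ℝ} (hℓ : ConcaveOn ℝ (Ici 0) ℓ)
    (hmono : MonotoneOn ℓ (Ici 0)) {t : ℝ} (ht : 0 < t) :
    ∃ s, 0 ≤ s ∧ ∀ t', 0 ≤ t' → ℓ t' ≤ ℓ t + s * (t' - t) := by
  -- The supergradient is the right derivative at t, taken as the supremum of the slopes to the
  -- right. The slopes to the left bound it from above.
  let σ : Ioi t → ℝ := fun t' => (ℓ t' - ℓ t) / (t' - t)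
  have hle : ∀ t₀, 0 ≤ t₀ → t₀ < t → ∀ t' : Ioi t, σ t' ≤ (ℓ t - ℓ t₀) / (t - t₀) :=
    fun t₀ h0 h1 t' => hℓ.slope_anti_adjacent (mem_Ici.2 h0)
      (mem_Ici.2 (ht.le.trans (le_of_lt t'.2))) h1 t'.2
  have hbdd : BddAbove (range σ) := ⟨_, forall_mem_range.2 (hle 0 le_rfl ht)⟩
  have : Nonempty (Ioi t) := ⟨⟨t + 1, by simp⟩⟩
  refine ⟨⨆ t', σ t', Real.iSup_nonneg fun t' => ?_, fun t' ht' => ?_⟩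
  · have h1 : t < t' := t'.2
    have h2 := hmono (mem_Ici.2 ht.le) (mem_Ici.2 (ht.le.trans h1.le)) h1.le
    exact div_nonneg (by linarith) (by linarith)
  · rcases lt_trichotomy t' t with h | rfl | h
    · have h1 := ciSup_le (hle t' ht' h)
      rw [le_div_iff₀ (by linarith)] at h1
      linarith
    · simp
    · have h1 : σ ⟨t', h⟩ ≤ ⨆ t', σ t' := le_ciSup hbdd _
      simp only [σ] at h1
      rw [div_le_iff₀ (by linarith)] at h1
      linarith

/-- The right side equals (‖z‖² + ‖w‖²)/(2‖z‖), so this is the arithmetic-geometric inequality. It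
is the quadratic upper expansion of the norm away from its singularity. -/
lemma norm_le_add_inner_add_sq {z w : Space d} (hz : z ≠ 0) :
    ‖w‖ ≤ ‖z‖ + inner ℝ z (w - z) / ‖z‖ + ‖w - z‖ ^ 2 / (2 * ‖z‖) := by
  have hpos : 0 < ‖z‖ := norm_pos_iff.2 hz
  have h1 : ‖w‖ ^ 2 = ‖z‖ ^ 2 + 2 * inner ℝ z (w - z) + ‖w - z‖ ^ 2 := by
    rw [← norm_add_sq_real, add_sub_cancel]
  have h2 : ‖z‖ + inner ℝ z (w - z) / ‖z‖ + ‖w - z‖ ^ 2 / (2 * ‖z‖) =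
      (‖z‖ ^ 2 + ‖w‖ ^ 2) / (2 * ‖z‖) := by rw [h1]; field_simp; ring
  rw [h2, le_div_iff₀ (by positivity)]
  nlinarith [sq_nonneg (‖z‖ - ‖w‖)]

/-- Away from its pole, a radial concave cost has bounded supergradients with uniform quadratic
error. -/
lemma exists_supergradient_radialCost {ℓ : ℝ → ℝ} (hℓ : ConcaveOn ℝ (Ici 0) ℓ)
    (hmono : MonotoneOn ℓ (Ici 0)) {ρ : ℝ} (hρ : 0 < ρ) {x y : Space d} (hxy : ρ ≤ ‖x - y‖) :
    ∃ p, ‖p‖ ≤ (ℓ ρ - ℓ 0) / ρ ∧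
      IsSupergradient (fun z => radialCost ℓ z y) univ ((ℓ ρ - ℓ 0) / ρ / (2 * ρ)) x p := by
  have hpos : 0 < ‖x - y‖ := hρ.trans_le hxy
  have hne : x - y ≠ 0 := norm_pos_iff.1 hpos
  obtain ⟨s, hs0, hs⟩ := exists_supergradient_of_concaveOn hℓ hmono hpos
  -- Testing the supergradient at ‖x - y‖ - ρ gives sρ ≤ ℓ(‖x - y‖) - ℓ(‖x - y‖ - ρ), and
  -- subadditivity bounds this by ℓ(ρ) - ℓ(0), whatever the distance.
  have hsM : s ≤ (ℓ ρ - ℓ 0) / ρ := by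
    rw [le_div_iff₀ hρ]
    have h1 := hs (‖x - y‖ - ρ) (by linarith)
    have h2 := concaveOn_subadditive hℓ (sub_nonneg.2 hxy) hρ.le
    rw [sub_add_cancel] at h2
    linarith
  refine ⟨(s / ‖x - y‖) • (x - y), ?_, fun z _ => ?_⟩
  · rwa [norm_smul, norm_div, norm_norm, div_mul_cancel₀ _ hpos.ne', Real.norm_of_nonneg hs0]
  · have h1 := hs ‖z - y‖ (norm_nonneg _)
    have h2 := norm_le_add_inner_add_sq (w := z - y) hne
    rw [sub_sub_sub_cancel_right] at h2
    have h3 := mul_le_mul_of_nonneg_left h2 hs0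
    have h4 : s * (‖z - x‖ ^ 2 / (2 * ‖x - y‖)) ≤
        (ℓ ρ - ℓ 0) / ρ / (2 * ρ) * ‖z - x‖ ^ 2 := by
      calc s * (‖z - x‖ ^ 2 / (2 * ‖x - y‖)) ≤ (ℓ ρ - ℓ 0) / ρ * (‖z - x‖ ^ 2 / (2 * ρ)) := by
            gcongr
            exact hs0.trans hsM
        _ = _ := by ring
    have h5 : inner ℝ ((s / ‖x - y‖) • (x - y)) (z - x) =
        s * (inner ℝ (x - y) (z - x) / ‖x - y‖) := by
      rw [real_inner_smul_left]; ring
    simp only [radialCost]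
    rw [h5]
    linarith

/-! ### The functions φ_i and their differentiability -/

section LocalPotential

variable {c : Space d → Space d → ℝ} {φ : Space d → ℝ}

lemma bddBelow_range_cost_sub_cTransform (h : ∀ x y, φ x + cTransform c φ y ≤ c x y)
    (B : Set (Space d)) (x : Space d) :
    BddBelow (range fun y : B => c x y - cTransform c φ y) :=
  ⟨φ x, forall_mem_range.2 fun y => by linarith [h x y]⟩

lemma localPotential_le (h : ∀ x y, φ x + cTransform c φ y ≤ c x y) {B : Set (Space d)}
    {y : Space d} (hy : y ∈ B) (x : Space d) :
    localPotential c φ B x ≤ c x y - cTransform c φ y :=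
  ciInf_le (bddBelow_range_cost_sub_cTransform h B x) (⟨y, hy⟩ : B)

/-- Every term of the infimum is at least φ(x), and the contact point y attains this value. -/
lemma eq_localPotential (h : ∀ x y, φ x + cTransform c φ y ≤ c x y) {B : Set (Space d)}
    {x y : Space d} (hy : y ∈ B) (hxy : φ x + cTransform c φ y = c x y) :
    φ x = localPotential c φ B x := by
  have : Nonempty B := ⟨⟨y, hy⟩⟩
  refine le_antisymm (le_ciInf fun z => by linarith [h x z]) ?_
  linarith [localPotential_le h hy x]

lemma exists_eq_localPotential {B : Set (Space d)} (hB : IsCompact B) (hne : B.Nonempty)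
    (hc : ∀ x, Continuous (c x)) (hφ : Continuous (cTransform c φ))
    (h : ∀ x y, φ x + cTransform c φ y ≤ c x y) (x : Space d) :
    ∃ y ∈ B, localPotential c φ B x = c x y - cTransform c φ y := by
  obtain ⟨y, hy, hmin⟩ := hB.exists_isMinOn hne ((hc x).sub hφ).continuousOn
  have : Nonempty B := hne.to_subtype
  refine ⟨y, hy, le_antisymm (localPotential_le h hy x) (le_ciInf fun z => hmin z.2)⟩

end LocalPotential

lemma continuous_radialCost {ℓ : ℝ → ℝ} (hℓ : ContinuousOn ℓ (Ici 0)) :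
    Continuous fun p : Space d × Space d => radialCost ℓ p.1 p.2 :=
  hℓ.comp_continuous (by fun_prop) fun _ => norm_nonneg _

lemma continuous_radialCost_right {ℓ : ℝ → ℝ} (hℓ : ContinuousOn ℓ (Ici 0)) (x : Space d) :
    Continuous (radialCost ℓ x) :=
  hℓ.comp_continuous (f := fun y => ‖x - y‖) (by fun_prop) fun _ => norm_nonneg _

/-- Away from `B`, the function `φ_B` is differentiable almost everywhere. -/
lemma measure_not_differentiableAt_localPotential (hd : 1 ≤ d) {μ : Measure (Space d)}
    (hμ : NotChargingSmallSets μ) {ℓ : ℝ → ℝ} (hcont : ContinuousOn ℓ (Ici 0))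
    (hℓ : ConcaveOn ℝ (Ici 0) ℓ) (hmono : MonotoneOn ℓ (Ici 0)) {φ : Space d → ℝ}
    (hφ : Continuous (cTransform (radialCost ℓ) φ))
    (h : ∀ x y, φ x + cTransform (radialCost ℓ) φ y ≤ radialCost ℓ x y)
    {B B' : Set (Space d)} (hB : IsCompact B) (hne : B.Nonempty)
    (hsep : Metric.AreSeparated B B') :
    μ {x ∈ B' | ¬ DifferentiableAt ℝ (localPotential (radialCost ℓ) φ B) x} = 0 := by
  obtain ⟨ρ', hρ'0, hρ'⟩ := hsep
  -- The separation constant may be infinite. A finite ρ strictly below it also makes {infDist > ρ}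
  -- an open set containing B'.
  obtain ⟨ρ, hρ0, hρ⟩ := ENNReal.lt_iff_exists_nnreal_btwn.1 (pos_iff_ne_zero.2 hρ'0)
  have hρ0' : (0 : ℝ) < ρ := by exact_mod_cast hρ0
  have hU : IsOpen {x : Space d | (ρ : ℝ) < Metric.infDist x B} :=
    isOpen_lt continuous_const (Metric.continuous_infDist_pt B)
  refine measure_mono_null ?_ (measure_not_differentiableAt_eq_zero hd hμ hU
    (f := localPotential (radialCost ℓ) φ B) (C := (ℓ ρ - ℓ 0) / ρ / (2 * ρ))
    (M := (ℓ ρ - ℓ 0) / ρ) ?_)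
  · rintro x ⟨hx, hxd⟩
    refine ⟨?_, hxd⟩
    obtain ⟨y, hy, hxy⟩ := hB.exists_infDist_eq_dist hne x
    have := hρ.trans_le (hρ' y hy x hx)
    rw [edist_comm, edist_nndist] at this
    simp only [mem_ofPred_eq, hxy]
    exact_mod_cast this
  · intro x hx
    -- At a minimiser y, the function z ↦ c(z, y) - φ^c(y) lies above φ_B and touches it at x, so
    -- its supergradients at x are supergradients of φ_B.
    obtain ⟨y, hy, hxy⟩ := exists_eq_localPotential (c := radialCost ℓ) hB hne
      (continuous_radialCost_right hcont) hφ h x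
    have hdist : (ρ : ℝ) ≤ ‖x - y‖ := by
      rw [← dist_eq_norm]
      exact le_of_lt (lt_of_lt_of_le hx (Metric.infDist_le_dist_of_mem hy))
    obtain ⟨p, hpM, hp⟩ := exists_supergradient_radialCost hℓ hmono hρ0' hdist
    refine ⟨p, hpM, fun z _ => ?_⟩
    have h1 := hp z (mem_univ _)
    have h2 := localPotential_le h hy z
    simp only at h1
    linarith

/-! ### Cyclical monotonicity of the support -/

lemma integrable_and_abs_integral_sub_le {α : Type*} [MeasurableSpace α] {π : Measure α}
    [IsProbabilityMeasure π] {f : α → ℝ} (hf : AEStronglyMeasurable f π) {a η : ℝ}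
    (h : ∀ᵐ p ∂π, |f p - a| ≤ η) : Integrable f π ∧ |∫ p, f p ∂π - a| ≤ η := by
  have hint : Integrable f π := by
    refine Integrable.of_bound hf (|a| + η) ?_
    filter_upwards [h] with p hp
    have := abs_add_le a (f p - a)
    rw [add_sub_cancel] at this
    rw [Real.norm_eq_abs]
    linarith
  refine ⟨hint, ?_⟩
  have h1 := norm_integral_le_of_norm_le_const (μ := π) (f := fun p => f p - a) h
  rw [integral_sub hint (integrable_const a)] at h1
  simpa using h1

open Filter Topology in
/-- The support of an optimal plan for a continuous cost is cyclically monotone. -/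
lemma IsOptimalPlan.sum_le_sum_perm {c : Space d → Space d → ℝ}
    (hc : Continuous fun p : Space d × Space d => c p.1 p.2) {μ ν : Measure (Space d)}
    {γ : Measure (Space d × Space d)} [IsFiniteMeasure γ] (hγ : IsOptimalPlan c μ ν γ)
    {ι : Type*} [Fintype ι] [Nonempty ι] (p : ι → Space d × Space d)
    (hp : ∀ i, p i ∈ γ.support) (σ : Equiv.Perm ι) :
    ∑ i, c (p i).1 (p i).2 ≤ ∑ i, c (p (σ i)).1 (p i).2 := by
  by_contra! hlt
  obtain ⟨η, hη, hη2⟩ : ∃ η > 0, ∑ i, (c (p (σ i)).1 (p i).2 + η) < ∑ i, (c (p i).1 (p i).2 - η) := by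
    have hcard : (0 : ℝ) < Fintype.card ι := by exact_mod_cast Fintype.card_pos
    obtain ⟨η, hη, h⟩ := exists_between (div_pos (sub_pos.2 hlt) (mul_pos two_pos hcard))
    refine ⟨η, hη, ?_⟩
    rw [lt_div_iff₀ (by positivity)] at h
    simp only [Finset.sum_add_distrib, Finset.sum_sub_distrib, Finset.sum_const,
      Finset.card_univ, nsmul_eq_mul]
    linarith
  have hev : ∀ q : Space d × Space d, ∀ᶠ r in 𝓝[>] (0 : ℝ),
      ∀ z ∈ Metric.ball q r, |c z.1 z.2 - c q.1 q.2| ≤ η := by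
    intro q
    obtain ⟨δ, hδ, h⟩ := Metric.continuous_iff.1 hc q η hη
    filter_upwards [Ioo_mem_nhdsGT hδ] with r hr z hz
    exact (h z (lt_trans hz hr.2)).le
  obtain ⟨r, ⟨hr1, hr2⟩, hr⟩ := (((eventually_all.2 fun i => hev (p i)).and
    (eventually_all.2 fun i => hev ((p (σ i)).1, (p i).2))).and self_mem_nhdsWithin).exists
  have hr : 0 < r := hr
  let W : ι → Set (Space d × Space d) := fun i => Metric.ball (p i) r
  have hWpos : ∀ i, γ (W i) ≠ 0 := fun i =>
    ((Measure.mem_support_iff_forall _).1 (hp i) _ (Metric.ball_mem_nhds _ hr)).ne'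
  let g : ι → Measure (Space d × Space d) := fun i => ProbabilityTheory.cond γ (W i)
  have hgprob : ∀ i, IsProbabilityMeasure (g i) := fun i =>
    ProbabilityTheory.cond_isProbabilityMeasure (hWpos i)
  have hgW : ∀ i, ∀ᵐ z ∂(g i), z ∈ W i := fun i =>
    ProbabilityTheory.ae_cond_mem Metric.isOpen_ball.measurableSet
  -- The rearrangement couples the sources near p (σ i) with the targets near p i. Summed over i,
  -- the marginals are unchanged.
  let π : ι → Measure (Space d × Space d) := fun i =>
    ((g (σ i)).map Prod.fst).prod ((g i).map Prod.snd)
  have hfst : ∀ i, IsProbabilityMeasure ((g i).map Prod.fst) := fun i =>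
    Measure.isProbabilityMeasure_map measurable_fst.aemeasurable
  have hsnd : ∀ i, IsProbabilityMeasure ((g i).map Prod.snd) := fun i =>
    Measure.isProbabilityMeasure_map measurable_snd.aemeasurable
  have hπW : ∀ i, ∀ᵐ z ∂(π i), z ∈ Metric.ball ((p (σ i)).1, (p i).2) r := by
    intro i
    have h1 : ∀ᵐ x ∂((g (σ i)).map Prod.fst), x ∈ Metric.ball (p (σ i)).1 r := by
      refine (ae_map_iff measurable_fst.aemeasurable Metric.isOpen_ball.measurableSet).2 ?_
      filter_upwards [hgW (σ i)] with z hz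
      exact (max_lt_iff.1 hz).1
    have h2 : ∀ᵐ x ∂((g i).map Prod.snd), x ∈ Metric.ball (p i).2 r := by
      refine (ae_map_iff measurable_snd.aemeasurable Metric.isOpen_ball.measurableSet).2 ?_
      filter_upwards [hgW i] with z hz
      exact (max_lt_iff.1 hz).2
    filter_upwards [Measure.quasiMeasurePreserving_fst.ae h1,
      Measure.quasiMeasurePreserving_snd.ae h2] with z hz1 hz2
    exact max_lt (Metric.mem_ball.1 hz1) (Metric.mem_ball.1 hz2)
  have hcg : ∀ i, Integrable (fun z => c z.1 z.2) (g i) ∧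
      |∫ z, c z.1 z.2 ∂(g i) - c (p i).1 (p i).2| ≤ η := fun i =>
    integrable_and_abs_integral_sub_le hc.aestronglyMeasurable
      ((hgW i).mono fun z hz => hr1 i z hz)
  have hcπ : ∀ i, Integrable (fun z => c z.1 z.2) (π i) ∧
      |∫ z, c z.1 z.2 ∂(π i) - c (p (σ i)).1 (p i).2| ≤ η := fun i =>
    integrable_and_abs_integral_sub_le hc.aestronglyMeasurable
      ((hπW i).mono fun z hz => hr2 i z hz)
  -- Each g i is at most γ(W i)⁻¹ γ, so this mass makes m ∑ g i ≤ γ even when the balls overlap or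
  -- points repeat. The competitor is then γ - τ + τ'.
  let m : ENNReal := (∑ i, (γ (W i))⁻¹)⁻¹
  have hm1 : ∑ i, (γ (W i))⁻¹ ≠ 0 := by
    obtain ⟨i⟩ := ‹Nonempty ι›
    intro h
    exact ENNReal.inv_ne_zero.2 (measure_ne_top γ (W i))
      ((Finset.sum_eq_zero_iff.1 h) i (Finset.mem_univ i))
  have hm2 : ∑ i, (γ (W i))⁻¹ ≠ ⊤ :=
    ENNReal.sum_ne_top.2 fun i _ => ENNReal.inv_ne_top.2 (hWpos i)
  have hm_top : m ≠ ⊤ := ENNReal.inv_ne_top.2 hm1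
  have hm_pos : 0 < m.toReal := ENNReal.toReal_pos (ENNReal.inv_ne_zero.2 hm2) hm_top
  let τ : Measure (Space d × Space d) := m • ∑ i, g i
  let τ' : Measure (Space d × Space d) := m • ∑ i, π i
  have hτγ : τ ≤ γ := by
    have h1 : ∑ i, g i ≤ (∑ i, (γ (W i))⁻¹) • γ := by
      rw [Finset.sum_smul]
      refine Finset.sum_le_sum fun i _ => ?_
      refine Measure.le_iff.2 fun s _ => ?_
      simp only [g, ProbabilityTheory.cond, Measure.smul_apply, smul_eq_mul]
      gcongr
      exact Measure.restrict_le_self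
    refine Measure.le_iff.2 fun s _ => ?_
    calc τ s = m * (∑ i, g i) s := by simp [τ]
      _ ≤ m * (((∑ i, (γ (W i))⁻¹) • γ) s) := by gcongr
      _ = γ s := by
        rw [Measure.smul_apply, smul_eq_mul, ← mul_assoc, ENNReal.inv_mul_cancel hm1 hm2, one_mul]
  have hτfin : IsFiniteMeasure τ := isFiniteMeasure_of_le γ hτγ
  have hsum : γ - τ + τ = γ := Measure.sub_add_cancel_of_le hτγ
  have hmap : ∀ (f : Space d × Space d → Space d), Measurable f →
      ∀ (κ : ι → Measure (Space d × Space d)), (m • ∑ i, κ i).map f = m • ∑ i, (κ i).map f := by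
    intro f hf κ
    rw [Measure.map_smul, ← Measure.mapₗ_apply_of_measurable hf, map_sum]
    simp only [Measure.mapₗ_apply_of_measurable hf]
  have hτfst : τ'.map Prod.fst = τ.map Prod.fst := by
    rw [hmap _ measurable_fst, hmap _ measurable_fst]
    simp only [π, Measure.map_fst_prod, measure_univ, one_smul]
    rw [Equiv.sum_comp σ fun i => (g i).map Prod.fst]
  have hτsnd : τ'.map Prod.snd = τ.map Prod.snd := by
    rw [hmap _ measurable_snd, hmap _ measurable_snd]
    simp only [π, Measure.map_snd_prod, measure_univ, one_smul]
  have hplan : IsTransportPlan μ ν (γ - τ + τ') := by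
    constructor
    · rw [Measure.map_add _ _ measurable_fst, hτfst, ← Measure.map_add _ _ measurable_fst, hsum]
      exact hγ.1.1
    · rw [Measure.map_add _ _ measurable_snd, hτsnd, ← Measure.map_add _ _ measurable_snd, hsum]
      exact hγ.1.2
  have hint : Integrable (fun z => c z.1 z.2) (γ - τ) := hγ.2.1.mono_measure Measure.sub_le
  have hintτ : Integrable (fun z => c z.1 z.2) τ := hγ.2.1.mono_measure hτγ
  have hintτ' : Integrable (fun z => c z.1 z.2) τ' :=
    (integrable_finsetSum_measure.2 fun i _ => (hcπ i).1).smul_measure hm_top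
  have hopt := hγ.2.2 _ hplan (hint.add_measure hintτ')
  have hγint : ∫ z, c z.1 z.2 ∂γ = ∫ z, c z.1 z.2 ∂(γ - τ) + ∫ z, c z.1 z.2 ∂τ := by
    rw [← integral_add_measure hint hintτ, hsum]
  rw [integral_add_measure hint hintτ', hγint, add_le_add_iff_left, integral_smul_measure,
    integral_smul_measure, integral_finsetSum_measure fun i _ => (hcg i).1,
    integral_finsetSum_measure fun i _ => (hcπ i).1, smul_eq_mul, smul_eq_mul,
    mul_le_mul_iff_right₀ hm_pos] at hopt
  have h1 : ∑ i, (c (p i).1 (p i).2 - η) ≤ ∑ i, ∫ z, c z.1 z.2 ∂(g i) :=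
    Finset.sum_le_sum fun i _ => by linarith [(abs_le.1 (hcg i).2).1]
  have h2 : ∑ i, ∫ z, c z.1 z.2 ∂(π i) ≤ ∑ i, (c (p (σ i)).1 (p i).2 + η) :=
    Finset.sum_le_sum fun i _ => by linarith [(abs_le.1 (hcπ i).2).2]
  linarith

/-! ### Potentials as shortest-path distances -/

section ShortestPath

variable {α : Type*}

/-- The starting points of the successive links of a chain issued from `o`. -/
def chainStart (o : α) (p : ℕ → α × α) : ℕ → α
  | 0 => o
  | i + 1 => (p i).2

/-- The cost of going from `o` to `u` through the first `n` links of a chain, each link being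
travelled at negative cost. -/
def chainCost (w : α → α → ℝ) (o : α) (n : ℕ) (p : ℕ → α × α) (u : α) : ℝ :=
  ∑ i ∈ Finset.range n, (w (chainStart o p i) (p i).1 - w (p i).1 (p i).2) +
    w (chainStart o p n) u

/-- Appending the link q and stopping at its end point. The entry at index n is free, since a chain
of length n does not read it. -/
lemma chainCost_update (w : α → α → ℝ) (o : α) (n : ℕ) (p : ℕ → α × α) (q : α × α) :
    chainCost w o (n + 1) (Function.update p n q) q.2 =
      chainCost w o n p q.1 - w q.1 q.2 + w q.2 q.2 := by
  have hstart : ∀ i ≤ n, chainStart o (Function.update p n q) i = chainStart o p i := by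
    rintro (_ | i) hi
    · rfl
    · simp [chainStart, Function.update_of_ne (show i ≠ n by omega)]
  have hsum : ∑ i ∈ Finset.range n, (w (chainStart o (Function.update p n q) i)
      (Function.update p n q i).1 - w (Function.update p n q i).1 (Function.update p n q i).2) =
      ∑ i ∈ Finset.range n, (w (chainStart o p i) (p i).1 - w (p i).1 (p i).2) := by
    refine Finset.sum_congr rfl fun i hi => ?_
    have := Finset.mem_range.1 hi
    rw [hstart i this.le, Function.update_of_ne this.ne]
  rw [chainCost, chainCost, Finset.sum_range_succ, hsum, hstart n le_rfl]
  simp [chainStart]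
  ring

/-- For a cost satisfying the triangle inequality, a cyclically monotone set is contained in the
contact set of a Lipschitz potential. -/
lemma exists_potential_of_cyclicallyMonotone [Nonempty α] {w : α → α → ℝ}
    (hself : ∀ x, w x x = 0) (hsymm : ∀ x y, w x y = w y x)
    (htri : ∀ x y z, w x z ≤ w x y + w y z) {S : Set (α × α)}
    (hS : ∀ (k : ℕ) (p : Fin (k + 1) → α × α), (∀ i, p i ∈ S) →
      ∑ i, w (p i).1 (p i).2 ≤ ∑ i, w (p (finRotate (k + 1) i)).1 (p i).2) :
    ∃ ψ : α → ℝ, (∀ u v, ψ u - ψ v ≤ w u v) ∧ ∀ p ∈ S, ψ p.1 - ψ p.2 = w p.1 p.2 := by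
  obtain ⟨o⟩ := ‹Nonempty α›
  let I := {q : ℕ × (ℕ → α × α) // ∀ i < q.1, q.2 i ∈ S}
  have hI : Nonempty I := ⟨⟨(0, fun _ => (o, o)), by simp⟩⟩
  let ψ : α → ℝ := fun u => ⨅ q : I, chainCost w o q.1.1 q.1.2 u
  -- Cyclical monotonicity handles the closed cycle of links, and the triangle inequality through o
  -- inserts the base point. This keeps the infimum ψ finite.
  have hclosed : ∀ q : I, 0 ≤ chainCost w o q.1.1 q.1.2 o := by
    rintro ⟨⟨n, p⟩, hp⟩
    rcases n with _ | k
    · simp [chainCost, chainStart, hself]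
    · have h1 := hS k (fun i => p i) fun i => hp i i.2
      rw [Fin.sum_univ_castSucc (fun i : Fin (k + 1) => w (p (finRotate (k + 1) i)).1 (p i).2),
        finRotate_last] at h1
      simp only [finRotate_apply, Fin.coeSucc_eq_succ, Fin.val_succ, Fin.val_castSucc,
        Fin.val_last, Fin.val_zero] at h1
      rw [Fin.sum_univ_eq_sum_range (fun i => w (p i).1 (p i).2) (k + 1),
        Fin.sum_univ_eq_sum_range (fun i => w (p (i + 1)).1 (p i).2) k] at h1
      have h2 := htri (p k).2 o (p 0).1
      rw [hsymm (p 0).1] at h1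
      simp only [chainCost, Finset.sum_sub_distrib]
      rw [Finset.sum_range_succ' (fun i => w (chainStart o p i) (p i).1)]
      simp only [chainStart]
      simp only [fun i => hsymm (p (i + 1)).1 (p i).2] at h1
      linarith
  have hLip : ∀ (q : I) u v, chainCost w o q.1.1 q.1.2 u ≤ chainCost w o q.1.1 q.1.2 v + w v u := by
    intro q u v
    have := htri (chainStart o q.1.2 q.1.1) v u
    simp only [chainCost]
    linarith
  have hbdd : ∀ u, BddBelow (range fun q : I => chainCost w o q.1.1 q.1.2 u) := fun u =>
    ⟨-w u o, forall_mem_range.2 fun q => by linarith [hLip q o u, hclosed q]⟩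
  have hψ : ∀ u v, ψ u - ψ v ≤ w u v := by
    intro u v
    have : ψ u - w u v ≤ ψ v := le_ciInf fun q => by
      linarith [ciInf_le (hbdd u) q, hLip q u v, hsymm u v]
    linarith
  refine ⟨ψ, hψ, fun p hp => le_antisymm (hψ _ _) ?_⟩
  have : ψ p.2 + w p.1 p.2 ≤ ψ p.1 := by
    refine le_ciInf fun q => ?_
    -- Prolonging any chain ending at p.1 by the link p costs -w p.1 p.2, hence ψ p.2 ≤ ψ p.1 - w
    -- p.1 p.2.
    let q' : I := ⟨(q.1.1 + 1, Function.update q.1.2 q.1.1 p), fun i hi => by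
      rcases (Nat.lt_succ_iff.1 hi).eq_or_lt with h | h
      · simpa [h] using hp
      · simpa [Function.update_of_ne h.ne] using q.2 i h⟩
    have h1 : ψ p.2 ≤ chainCost w o q'.1.1 q'.1.2 p.2 := ciInf_le (hbdd p.2) q'
    have h2 := chainCost_update w o q.1.1 q.1.2 p
    rw [hself] at h2
    simp only [q'] at h1
    linarith
  linarith

end ShortestPath

/-! ### Complementary slackness -/

lemma IsTransportPlan.isProbabilityMeasure {μ ν : Measure (Space d)} [IsProbabilityMeasure μ]
    {γ : Measure (Space d × Space d)} (hγ : IsTransportPlan μ ν γ) : IsProbabilityMeasure γ := by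
  refine ⟨?_⟩
  have h := congrArg (fun m => m univ) hγ.1
  simpa [Measure.map_apply measurable_fst MeasurableSet.univ] using h

lemma IsTransportPlan.integrable_add {μ ν : Measure (Space d)} {γ : Measure (Space d × Space d)}
    (hγ : IsTransportPlan μ ν γ) {f g : Space d → ℝ} (hf : Integrable f μ) (hg : Integrable g ν) :
    Integrable (fun p => f p.1 + g p.2) γ ∧
      ∫ p, (f p.1 + g p.2) ∂γ = ∫ x, f x ∂μ + ∫ y, g y ∂ν := by
  obtain ⟨h1, h2⟩ := hγ
  rw [← h1] at hf
  rw [← h2] at hg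
  have hf' : Integrable (fun p : Space d × Space d => f p.1) γ := hf.comp_measurable measurable_fst
  have hg' : Integrable (fun p : Space d × Space d => g p.2) γ := hg.comp_measurable measurable_snd
  refine ⟨hf'.add hg', ?_⟩
  rw [integral_add hf' hg', ← h1, ← h2, integral_map measurable_fst.aemeasurable hf.1,
    integral_map measurable_snd.aemeasurable hg.1]

section RadialDistance

variable {ℓ : ℝ → ℝ}

lemma radialCost_self (x : Space d) : radialCost ℓ x x = ℓ 0 := by simp [radialCost]

lemma radialCost_comm (x y : Space d) : radialCost ℓ x y = radialCost ℓ y x := by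
  simp [radialCost, norm_sub_rev]

lemma le_radialCost (hmono : MonotoneOn ℓ (Ici 0)) (x y : Space d) : ℓ 0 ≤ radialCost ℓ x y :=
  hmono self_mem_Ici (mem_Ici.2 (norm_nonneg _)) (norm_nonneg _)

/-- Up to the additive constant `ℓ 0`, a radial concave monotone cost is a distance. -/
lemma radialCost_triangle (hℓ : ConcaveOn ℝ (Ici 0) ℓ) (hmono : MonotoneOn ℓ (Ici 0))
    (x y z : Space d) :
    radialCost ℓ x z - ℓ 0 ≤ (radialCost ℓ x y - ℓ 0) + (radialCost ℓ y z - ℓ 0) := by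
  have h1 := hmono (mem_Ici.2 (norm_nonneg (x - z)))
    (mem_Ici.2 (add_nonneg (norm_nonneg (x - y)) (norm_nonneg (y - z))))
    (norm_sub_le_norm_sub_add_norm_sub x y z)
  have h2 := concaveOn_subadditive hℓ (norm_nonneg (x - y)) (norm_nonneg (y - z))
  simp only [radialCost]
  linarith

end RadialDistance

/-- Truncation of a real number at height `n`. -/
noncomputable def clamp (n : ℕ) (t : ℝ) : ℝ := max (-(n : ℝ)) (min t n)

/-- Truncation is nondecreasing and 1-Lipschitz. The condition 0 ≤ δ is needed because truncation
can bring a negative difference up to 0. -/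
lemma clamp_sub_clamp_le {n : ℕ} {s t δ : ℝ} (hδ : 0 ≤ δ) (h : s - t ≤ δ) :
    clamp n s - clamp n t ≤ δ := by
  have hn : (0 : ℝ) ≤ n := n.cast_nonneg
  rw [clamp, clamp, sub_le_iff_le_add]
  refine max_le ?_ ?_
  · linarith [le_max_left (-(n : ℝ)) (min t n)]
  · rcases min_cases t (n : ℝ) with ⟨h1, _⟩ | ⟨h1, _⟩
    · linarith [le_max_right (-(n : ℝ)) (min t n), min_le_left s (n : ℝ)]
    · linarith [le_max_right (-(n : ℝ)) (min t n), min_le_right s (n : ℝ)]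

lemma abs_clamp_le (n : ℕ) (t : ℝ) : |clamp n t| ≤ n := by
  have hn : (0 : ℝ) ≤ n := n.cast_nonneg
  exact abs_le.2 ⟨le_max_left _ _, max_le (by linarith) (min_le_right _ _)⟩

lemma continuous_clamp (n : ℕ) : Continuous (clamp n) := by unfold clamp; fun_prop

open Filter Topology in
lemma tendsto_clamp (t : ℝ) : Tendsto (fun n => clamp n t) atTop (𝓝 t) := by
  refine tendsto_const_nhds.congr' ?_
  filter_upwards [eventually_ge_atTop ⌈|t|⌉₊] with n hn
  have h := abs_le.1 ((Nat.le_ceil _).trans (Nat.cast_le.2 hn) : |t| ≤ n)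
  rw [clamp, min_eq_left h.2, max_eq_right h.1]

/-- A function that is `1`-Lipschitz for the radial cost yields, after truncation, admissible pairs
of the dual problem. -/
lemma isDualAdmissible_clamp {ℓ : ℝ → ℝ} (hmono : MonotoneOn ℓ (Ici 0)) {μ ν : Measure (Space d)}
    [IsFiniteMeasure μ] [IsFiniteMeasure ν] {ψ : Space d → ℝ} (hψc : Continuous ψ)
    (hψ : ∀ u v, ψ u - ψ v ≤ radialCost ℓ u v - ℓ 0) (n : ℕ) :
    IsDualAdmissible (radialCost ℓ) μ ν (fun x => clamp n (ψ x) + ℓ 0)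
      (fun y => -clamp n (ψ y)) := by
  have hcont : Continuous fun x => clamp n (ψ x) := (continuous_clamp n).comp hψc
  have hint : ∀ (m : Measure (Space d)) [IsFiniteMeasure m],
      Integrable (fun x => clamp n (ψ x)) m := fun m _ =>
    Integrable.of_bound hcont.aestronglyMeasurable n
      (Filter.Eventually.of_forall fun x => abs_clamp_le n (ψ x))
  refine ⟨hcont.add continuous_const, hcont.neg, (hint μ).add (integrable_const _), (hint ν).neg,
    fun x y => ?_⟩
  have := clamp_sub_clamp_le (n := n) (sub_nonneg.2 (le_radialCost hmono x y)) (hψ x y)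
  linarith

open Filter Topology in
/-- Complementary slackness: a Kantorovich potential saturates the constraint on the support of
every optimal plan. -/
lemma add_cTransform_eq_of_mem_support {ℓ : ℝ → ℝ} (hcont : ContinuousOn ℓ (Ici 0))
    (hℓ : ConcaveOn ℝ (Ici 0) ℓ) (hmono : MonotoneOn ℓ (Ici 0)) {μ ν : Measure (Space d)}
    [IsProbabilityMeasure μ] [IsProbabilityMeasure ν] {γ : Measure (Space d × Space d)}
    (hγ : IsOptimalPlan (radialCost ℓ) μ ν γ) {φ : Space d → ℝ}
    (hφ : IsKantorovichPotential (radialCost ℓ) μ ν φ) {p : Space d × Space d}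
    (hp : p ∈ γ.support) :
    φ p.1 + cTransform (radialCost ℓ) φ p.2 = radialCost ℓ p.1 p.2 := by
  have hγprob : IsProbabilityMeasure γ := hγ.1.isProbabilityMeasure
  have hc := continuous_radialCost (d := d) hcont
  obtain ⟨ψ, hψ, hψS⟩ := exists_potential_of_cyclicallyMonotone
    (w := fun x y : Space d => radialCost ℓ x y - ℓ 0) (S := γ.support)
    (fun x => by simp [radialCost_self]) (fun x y => by rw [radialCost_comm])
    (radialCost_triangle hℓ hmono) (fun k q hq => by
      simpa only [Finset.sum_sub_distrib, sub_le_sub_iff_right] using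
        hγ.sum_le_sum_perm hc q hq (finRotate (k + 1)))
  have hψc : Continuous ψ := by
    refine continuous_iff_continuousAt.2 fun x => tendsto_iff_dist_tendsto_zero.2 ?_
    have h0 : Tendsto (fun z => radialCost ℓ x z - ℓ 0) (𝓝 x) (𝓝 0) := by
      have := ((continuous_radialCost_right hcont x).tendsto x).sub_const (ℓ 0)
      simpa [radialCost_self] using this
    refine squeeze_zero (fun _ => dist_nonneg) (fun z => ?_) h0
    rw [Real.dist_eq, abs_sub_le_iff]
    exact ⟨by rw [radialCost_comm]; exact hψ z x, hψ x z⟩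
  -- The pair (ψ + ℓ(0), -ψ) would be optimal but need not be integrable, so its truncations are
  -- compared with (φ, φ^c). In the limit this gives ∫ c dγ ≤ ∫ φ dμ + ∫ φ^c dν. Domination is by
  -- |ℓ(0)| + c - ℓ(0), as truncation does not increase the oscillation of ψ.
  have hle : ∀ n : ℕ, ∫ q, ((clamp n (ψ q.1) + ℓ 0) + -clamp n (ψ q.2)) ∂γ ≤
      ∫ q, (φ q.1 + cTransform (radialCost ℓ) φ q.2) ∂γ := by
    intro n
    have hadm := isDualAdmissible_clamp (μ := μ) (ν := ν) hmono hψc hψ n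
    rw [(hγ.1.integrable_add hadm.integrable_left hadm.integrable_right).2,
      (hγ.1.integrable_add hφ.1.integrable_left hφ.1.integrable_right).2]
    exact hφ.2 _ _ hadm
  have hlim : Tendsto (fun n : ℕ => ∫ q, ((clamp n (ψ q.1) + ℓ 0) + -clamp n (ψ q.2)) ∂γ) atTop
      (𝓝 (∫ q, radialCost ℓ q.1 q.2 ∂γ)) := by
    refine tendsto_integral_of_dominated_convergence
      (fun q => |ℓ 0| + (radialCost ℓ q.1 q.2 - ℓ 0)) (fun n => ?_)
      ((integrable_const _).add (hγ.2.1.sub (integrable_const _)))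
      (fun n => Eventually.of_forall fun q => ?_) ?_
    · have := continuous_clamp n
      exact Continuous.aestronglyMeasurable (by fun_prop)
    · have h0 := sub_nonneg.2 (le_radialCost hmono q.1 q.2)
      have h1 := clamp_sub_clamp_le (n := n) h0 (hψ q.1 q.2)
      have h2 := clamp_sub_clamp_le (n := n) h0
        (show ψ q.2 - ψ q.1 ≤ _ by rw [radialCost_comm]; exact hψ q.2 q.1)
      have h3 := neg_abs_le (ℓ 0)
      have h4 := le_abs_self (ℓ 0)
      rw [Real.norm_eq_abs, abs_le]
      constructor <;> linarith
    · filter_upwards [Measure.support_mem_ae (μ := γ)] with q hq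
      have h1 := ((tendsto_clamp (ψ q.1)).add_const (ℓ 0)).add (tendsto_clamp (ψ q.2)).neg
      have h2 := hψS q hq
      have h3 : ψ q.1 + ℓ 0 + -ψ q.2 = radialCost ℓ q.1 q.2 := by linarith
      rwa [h3] at h1
  have hge := le_of_tendsto' hlim hle
  have hφint := (hγ.1.integrable_add hφ.1.integrable_left hφ.1.integrable_right).1
  have hzero : ∀ᵐ q ∂γ, φ q.1 + cTransform (radialCost ℓ) φ q.2 = radialCost ℓ q.1 q.2 := by
    have hnonneg : 0 ≤ fun q : Space d × Space d =>
        radialCost ℓ q.1 q.2 - (φ q.1 + cTransform (radialCost ℓ) φ q.2) :=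
      fun q => sub_nonneg.2 (hφ.1.add_le q.1 q.2)
    have hint0 : ∫ q, (radialCost ℓ q.1 q.2 - (φ q.1 + cTransform (radialCost ℓ) φ q.2)) ∂γ = 0 := by
      refine le_antisymm ?_ (integral_nonneg hnonneg)
      rw [integral_sub hγ.2.1 hφint]
      linarith
    filter_upwards [(integral_eq_zero_iff_of_nonneg hnonneg (hγ.2.1.sub hφint)).1 hint0] with q hq
    exact (sub_eq_zero.1 hq).symm
  have hclosed : IsClosed {q : Space d × Space d |
      φ q.1 + cTransform (radialCost ℓ) φ q.2 = radialCost ℓ q.1 q.2} :=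
    isClosed_eq ((hφ.1.continuous_left.comp continuous_fst).add
      (hφ.1.continuous_right.comp continuous_snd)) hc
  exact Measure.support_subset_of_isClosed hclosed hzero hp

/-! ### Full measure of A and negligibility of N -/

lemma measure_diagonal_eq_zero {μ ν : Measure (Space d)} (hμν : μ.MutuallySingular ν)
    {γ : Measure (Space d × Space d)} (hγ : IsTransportPlan μ ν γ) :
    γ (diagonal (Space d)) = 0 := by
  obtain ⟨S, hS, hμS, hνS⟩ := hμν
  rw [← hγ.1, Measure.map_apply measurable_fst hS] at hμS
  rw [← hγ.2, Measure.map_apply measurable_snd hS.compl] at hνS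
  refine measure_mono_null ?_ (measure_union_null hμS hνS)
  rintro ⟨x, y⟩ hxy
  obtain rfl : x = y := hxy
  exact em (x ∈ S)

/-- Projections of Borel sets need not be Borel. Here the projected set is closed minus closed in a
σ-compact metric space, hence σ-compact, and so is its image. -/
lemma measurableSet_movedSet (γ : Measure (Space d × Space d)) : MeasurableSet (movedSet γ) := by
  have hF : IsOpen ((diagonal (Space d))ᶜ) := isClosed_diagonal.isOpen_compl
  obtain ⟨F, hFc, -, hFU, -⟩ := hF.exists_iUnion_isClosed
  have hσ : IsSigmaCompact (γ.support \ diagonal (Space d)) := by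
    rw [sdiff_eq, ← hFU, inter_iUnion]
    exact isSigmaCompact_iUnion _ fun n => isSigmaCompact_univ.of_isClosed_subset
      (Measure.isClosed_support.inter (hFc n)) (subset_univ _)
  obtain ⟨K, hK, hKU⟩ := hσ.image continuous_fst
  rw [movedSet, ← hKU]
  exact MeasurableSet.iUnion fun n => (hK n).measurableSet

lemma measure_movedSet {μ ν : Measure (Space d)} [IsProbabilityMeasure μ]
    (hμν : μ.MutuallySingular ν) {γ : Measure (Space d × Space d)} (hγ : IsTransportPlan μ ν γ) :
    μ (movedSet γ) = 1 := by
  have hγprob : IsProbabilityMeasure γ := hγ.isProbabilityMeasure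
  have h : γ (Prod.fst ⁻¹' movedSet γ) = 1 := by
    refine (mem_ae_iff_prob_eq_one (measurable_fst (measurableSet_movedSet γ))).1 ?_
    filter_upwards [Measure.support_mem_ae (μ := γ),
      measure_eq_zero_iff_ae_notMem.1 (measure_diagonal_eq_zero hμν hγ)] with p hp hpd
    exact ⟨p, ⟨hp, hpd⟩, rfl⟩
  rw [← Measure.map_apply measurable_fst (measurableSet_movedSet γ), hγ.1] at h
  exact h

lemma measure_exceptionalSet (hd : 1 ≤ d) {μ : Measure (Space d)} (hμ : NotChargingSmallSets μ)
    {ℓ : ℝ → ℝ} (hcont : ContinuousOn ℓ (Ici 0)) (hℓ : ConcaveOn ℝ (Ici 0) ℓ)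
    (hmono : MonotoneOn ℓ (Ici 0)) {φ : Space d → ℝ}
    (hφ : Continuous (cTransform (radialCost ℓ) φ))
    (h : ∀ x y, φ x + cTransform (radialCost ℓ) φ y ≤ radialCost ℓ x y)
    {ι : Type*} [Countable ι] {B : ι → Set (Space d)} (hB : ∀ i, IsCompact (B i))
    (hne : ∀ i, (B i).Nonempty) : μ (exceptionalSet (radialCost ℓ) μ φ B) = 0 :=
  measure_union_null
    (measure_iUnion_null fun _ => measure_iUnion_null fun _ => measure_diff_isotropicSet hd hμ _)
    (measure_iUnion_null fun i => measure_iUnion_null fun _ => measure_iUnion_null fun hsep =>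
      measure_not_differentiableAt_localPotential hd hμ hcont hℓ hmono hφ h (hB i) (hne i) hsep)

/-! ### Separating balls and equality of gradients -/

/-- Two distinct points are contained in two closed balls of the family at positive distance. -/
lemma exists_areSeparated_closedBall {ι : Type*} {a : ι → Space d} {r : ι → ℝ} (hr : ∀ i, 0 < r i)
    (hbasis : TopologicalSpace.IsTopologicalBasis (range fun i => Metric.ball (a i) (r i)))
    {x y : Space d} (hxy : x ≠ y) :
    ∃ i j, y ∈ Metric.closedBall (a i) (r i) ∧ x ∈ Metric.closedBall (a j) (r j) ∧
      Metric.AreSeparated (Metric.closedBall (a i) (r i)) (Metric.closedBall (a j) (r j)) := by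
  have hpos : 0 < dist x y := dist_pos.2 hxy
  have key : ∀ z : Space d, ∃ i, z ∈ Metric.closedBall (a i) (r i) ∧
      Metric.closedBall (a i) (r i) ⊆ Metric.closedBall z (dist x y / 4) := by
    intro z
    obtain ⟨_, ⟨i, rfl⟩, hz, hsub⟩ := hbasis.exists_subset_of_mem_open
      (Metric.mem_ball_self (by positivity : 0 < dist x y / 4)) Metric.isOpen_ball
    refine ⟨i, Metric.ball_subset_closedBall hz, ?_⟩
    rw [← closure_ball (a i) (hr i).ne']
    exact (closure_mono hsub).trans Metric.closure_ball_subset_closedBall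
  obtain ⟨i, hyi, hi⟩ := key y
  obtain ⟨j, hxj, hj⟩ := key x
  refine ⟨i, j, hyi, hxj, ENNReal.ofReal (dist x y / 2), by simpa using hpos, fun p hp q hq => ?_⟩
  rw [edist_dist]
  refine ENNReal.ofReal_le_ofReal ?_
  have h1 := Metric.mem_closedBall.1 (hi hp)
  have h2 := Metric.mem_closedBall.1 (hj hq)
  have h3 := dist_triangle4 x q p y
  rw [dist_comm x q, dist_comm q p] at h3
  linarith

/-- Functions which agree on a set seen in all directions from `x` have the same gradient
at `x`. -/
lemma gradient_eq_of_mem_isotropicSet {μ : Measure (Space d)} (hμ : NotChargingSmallSets μ)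
    {E : Set (Space d)} {f g : Space d → ℝ} (hfg : EqOn f g E) {x : Space d} (hxE : x ∈ E)
    (hx : x ∈ isotropicSet (μ.restrict E)) (hf : DifferentiableAt ℝ f x)
    (hg : DifferentiableAt ℝ g x) : ∇ f x = ∇ g x := by
  by_contra hne
  have hw : 0 < ‖∇ f x - ∇ g x‖ := norm_pos_iff.2 (sub_ne_zero.2 hne)
  set w := ∇ f x - ∇ g x with hw_def
  have hfder := hasGradientAt_iff_hasFDerivAt.1 hf.hasGradientAt
  have hgder := hasGradientAt_iff_hasFDerivAt.1 hg.hasGradientAt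
  have hder := hfder.sub hgder
  rw [hasFDerivAt_iff_isLittleO, Asymptotics.isLittleO_iff] at hder
  -- On the cone of aperture 1/2 around w, ⟨w, y - x⟩ ≥ ‖w‖‖y - x‖/2. Where f = g, differentiability
  -- gives at most a quarter of ‖w‖‖y - x‖, a contradiction as soon as y ≠ x.
  obtain ⟨ε, hε, hball⟩ := Metric.eventually_nhds_iff.1 (hder (by positivity : 0 < ‖w‖ / 4))
  have hcone := hx (‖w‖⁻¹ • w) (by rw [norm_smul, norm_inv, norm_norm, inv_mul_cancel₀ hw.ne'])
    (1 / 2) (by norm_num) (ε / 2) (by positivity)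
  have hatom : μ.restrict E {x} = 0 :=
    nonpos_iff_eq_zero.1 ((Measure.restrict_apply_le _ _).trans (hμ.noAtoms x).le)
  -- Positive mass of the cone provides a point of E, and the absence of atoms lets it differ from
  -- x. The set E may be nonmeasurable, so the restricted measure is evaluated through measurability
  -- of the cone.
  obtain ⟨y, ⟨hyC, hyx⟩, hyE⟩ : ((cone x (‖w‖⁻¹ • w) (1 / 2) (ε / 2) \ {x}) ∩ E).Nonempty := by
    rw [nonempty_iff_ne_empty]
    intro hempty
    have hms : MeasurableSet (cone x (‖w‖⁻¹ • w) (1 / 2) (ε / 2) \ {x}) := by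
      refine MeasurableSet.diff (IsClosed.measurableSet ?_) (measurableSet_singleton x)
      exact (isClosed_le (by fun_prop) (by fun_prop)).inter Metric.isClosed_closedBall
    have h0 : μ.restrict E (cone x (‖w‖⁻¹ • w) (1 / 2) (ε / 2) \ {x}) = 0 := by
      rw [Measure.restrict_apply hms, hempty, measure_empty]
    refine hcone.ne' (measure_mono_null ?_ (measure_union_null h0 hatom))
    rw [sdiff_union_self]
    exact subset_union_left
  have hyx' : 0 < ‖y - x‖ := norm_pos_iff.2 (sub_ne_zero.2 hyx)
  have h1 := hball (lt_of_le_of_lt (Metric.mem_closedBall.1 hyC.2) (half_lt_self hε))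
  have h2 := hyC.1
  simp only [mem_ofPred_eq, inner_smul_right] at h2
  rw [← map_sub, ← hw_def] at h1
  simp only [Pi.sub_apply, hfg hyE, hfg hxE, sub_self, zero_sub, norm_neg,
    InnerProductSpace.toDual_apply_apply] at h1
  rw [real_inner_comm, inv_mul_eq_div, le_div_iff₀ hw] at h2
  have h3 := (le_abs_self _).trans h1
  nlinarith [mul_pos hw hyx']

end ConcaveTransport

/-! ### The ad hoc gradient -/

open ConcaveTransport
theorem mainTheorem8 {d : ℕ} (hd : 1 ≤ d)
    (ℓ : ℝ → ℝ) (hℓ_cont : ContinuousOn ℓ (Ici 0))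
    (hℓ_conc : StrictConcaveOn ℝ (Ici 0) ℓ) (hℓ_mono : MonotoneOn ℓ (Ici 0))
    (μ ν : Measure (Space d)) [IsProbabilityMeasure μ] [IsProbabilityMeasure ν]
    (hμν : μ.MutuallySingular ν) (hμ : NotChargingSmallSets μ)
    (γ : Measure (Space d × Space d)) (hγ : IsOptimalPlan (radialCost ℓ) μ ν γ)
    (φ : Space d → ℝ) (hφ : IsKantorovichPotential (radialCost ℓ) μ ν φ)
    {ι : Type*} [Countable ι] (a : ι → Space d) (r : ι → ℝ) (hr : ∀ i, 0 < r i)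
    (hbasis : TopologicalSpace.IsTopologicalBasis (range fun i => Metric.ball (a i) (r i)))
    (B : ι → Set (Space d)) (hB : ∀ i, B i = Metric.closedBall (a i) (r i)) :
    μ (exceptionalSet (radialCost ℓ) μ φ B) = 0 ∧
    μ (movedSet γ) = 1 ∧
    (∀ x ∈ movedSet γ \ exceptionalSet (radialCost ℓ) μ φ B,
      (∃ i, φ x = localPotential (radialCost ℓ) φ (B i) x ∧
        DifferentiableAt ℝ (localPotential (radialCost ℓ) φ (B i)) x) ∧
      ∀ i i', φ x = localPotential (radialCost ℓ) φ (B i) x →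
        φ x = localPotential (radialCost ℓ) φ (B i') x →
        DifferentiableAt ℝ (localPotential (radialCost ℓ) φ (B i)) x →
        DifferentiableAt ℝ (localPotential (radialCost ℓ) φ (B i')) x →
        ∇ (localPotential (radialCost ℓ) φ (B i)) x =
          ∇ (localPotential (radialCost ℓ) φ (B i')) x) ∧
    ∀ᵐ x ∂μ, ∃! v, IsAdHocGradient (radialCost ℓ) φ B x v := by
  have hconc := hℓ_conc.concaveOn
  have hadm := hφ.1
  have hBc : ∀ i, IsCompact (B i) := fun i => by
    rw [hB]; exact isCompact_closedBall _ _
  have hBne : ∀ i, (B i).Nonempty := fun i => by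
    rw [hB]; exact Metric.nonempty_closedBall.2 (hr i).le
  have hN := measure_exceptionalSet hd hμ hℓ_cont hconc hℓ_mono hadm.continuous_right hadm.add_le
    hBc hBne
  have hA := measure_movedSet hμν hγ.1
  have hgrad : ∀ x ∈ movedSet γ \ exceptionalSet (radialCost ℓ) μ φ B,
      (∃ i, φ x = localPotential (radialCost ℓ) φ (B i) x ∧
        DifferentiableAt ℝ (localPotential (radialCost ℓ) φ (B i)) x) ∧
      ∀ i i', φ x = localPotential (radialCost ℓ) φ (B i) x →
        φ x = localPotential (radialCost ℓ) φ (B i') x →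
        DifferentiableAt ℝ (localPotential (radialCost ℓ) φ (B i)) x →
        DifferentiableAt ℝ (localPotential (radialCost ℓ) φ (B i')) x →
        ∇ (localPotential (radialCost ℓ) φ (B i)) x =
          ∇ (localPotential (radialCost ℓ) φ (B i')) x := by
    rintro x ⟨⟨⟨x, y⟩, ⟨hsupp, hxy⟩, rfl⟩, hxN⟩
    simp only [exceptionalSet, mem_union, mem_iUnion, not_or, not_exists] at hxN
    refine ⟨?_, fun i i' hi hi' hdi hdi' => ?_⟩
    -- The ball B_i around the target y makes φ_i touch φ at x, and the separated ball B_j around x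
    -- puts x where avoiding N means differentiability of φ_i.
    · obtain ⟨i, j, hyi, hxj, hsep⟩ := exists_areSeparated_closedBall hr hbasis hxy
      rw [← hB] at hyi hxj hsep
      rw [← hB] at hsep
      refine ⟨i, eq_localPotential hadm.add_le hyi
        (add_cTransform_eq_of_mem_support hℓ_cont hconc hℓ_mono hγ hφ hsupp), ?_⟩
      by_contra hnd
      exact hxN.2 i j hsep ⟨hxj, hnd⟩
    · have hmem : x ∈ coincidenceSet (radialCost ℓ) φ (B i) (B i') := ⟨hi, hi'⟩
      refine gradient_eq_of_mem_isotropicSet hμ (fun z hz => hz.1.symm.trans hz.2) hmem ?_ hdi hdi'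
      by_contra hiso
      exact hxN.1 i i' ⟨hmem, hiso⟩
  refine ⟨hN, hA, hgrad, ?_⟩
  filter_upwards [(mem_ae_iff_prob_eq_one (measurableSet_movedSet γ)).2 hA,
    measure_eq_zero_iff_ae_notMem.1 hN] with x hxA hxN
  obtain ⟨⟨i, hi, hdi⟩, huniq⟩ := hgrad x ⟨hxA, hxN⟩
  refine ⟨_, ⟨i, hi, hdi.hasGradientAt⟩, ?_⟩
  rintro v ⟨j, hj, hv⟩
  rw [← hv.gradient]
  exact huniq j i hj hi hv.differentiableAt hdi
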